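/- A continuum is a nonempty compact connected metric space; a subcontinuum of $X$ is a subset of $X$ that is a continuum. Let $X$ be a continuum, let $2^X$ be the set of nonempty closed subsets of $X$ with the Hausdorff metric, and let $\mathcal{F}_1(X)=\{\{x\}:x\in X\}\subseteq 2^X$. Let $\mathcal{NB}(\mathcal{F}_1(X))$ be the subspace of $2^X$ consisting of all $A\in 2^X$ with $A\neq X$ such that, for every $x\in X\setminus A$, the union of all subcontinua $L$ of $X$ with $x\in L\subseteq X\setminus A$ is dense in $X$. Suppose that 1. $X$ is decomposable, that is, $X$ is the union of two proper subcontinua; 2. $X$ has the property of Kelley, that is, whenever $x_n\to x$ in $X$ and $A$ is a subcontinuum of $X$ with $x\in A$, there are subcontinua $A_n$ of $X$ with $x_n\in A_n$ for every $n$ and $A_n\to A$ in $2^X$; 3. $\mathcal{F}_1(X)\subseteq\mathcal{NB}(\mathcal{F}_1(X))$; 4. $\mathcal{NB}(\mathcal{F}_1(X))$ is a continuum. Then $X$ is aposyndetic: for all $p,q\in X$ with $p\neq q$ there is a subcontinuum $W$ of $X$ such that $p\in\mathrm{Int}(W)\subseteq W\subseteq X\setminus\{q\}$. -/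

import Mathlib

open Set Filter Topology TopologicalSpace

namespace ContinuumTheory

/-- A subset of a metric space is a continuum if it is nonempty, compact and connected
(`IsConnected` includes non-emptiness). Subcontinua are the continua contained in a given set. -/
def IsContinuum {Y : Type*} [MetricSpace Y] (K : Set Y) : Prop :=
  IsCompact K ∧ IsConnected K

/-- A space is decomposable if it is the union of two of its proper subcontinua. -/
def Decomposable (X : Type*) [MetricSpace X] : Prop :=
  ∃ M N : Set X, IsContinuum M ∧ IsContinuum N ∧ M ≠ univ ∧ N ≠ univ ∧ M ∪ N = univ

/-- The property of Kelley. For a compact metric space `X`, the hyperspace `2^X` of nonempty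
closed subsets with the Hausdorff metric is `NonemptyCompacts X`. -/
def PropertyOfKelley (X : Type*) [MetricSpace X] : Prop :=
  ∀ (x : ℕ → X) (a : X), Tendsto x atTop (𝓝 a) →
    ∀ A : NonemptyCompacts X, IsContinuum (A : Set X) → a ∈ A →
      ∃ B : ℕ → NonemptyCompacts X,
        (∀ n, IsContinuum (B n : Set X) ∧ x n ∈ B n) ∧ Tendsto B atTop (𝓝 A)

/-- `kappa A x` is the union of all subcontinua of `X` that contain `x` and lie in `X \ A`. -/
def kappa {X : Type*} [MetricSpace X] (A : Set X) (x : X) : Set X :=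
  ⋃₀ {L : Set X | IsContinuum L ∧ x ∈ L ∧ L ⊆ Aᶜ}

/-- The family `F₁(X)` of one-point subsets of `X`. -/
def singletons (X : Type*) [MetricSpace X] : Set (NonemptyCompacts X) :=
  range fun x : X => ({x} : NonemptyCompacts X)

/-- The hyperspace `NB(F₁(X))` of nonblockers of `F₁(X)`: the proper nonempty closed subsets `A`
of `X` such that `kappa A x` is dense in `X` for each `x` outside `A`. -/
def nonblockers (X : Type*) [MetricSpace X] : Set (NonemptyCompacts X) :=
  {A | (A : Set X) ≠ univ ∧ ∀ x : X, x ∉ A → Dense (kappa (A : Set X) x)}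

/-- `X` is aposyndetic at `p` with respect to `q`. -/
def AposyndeticAtWrt {X : Type*} [MetricSpace X] (p q : X) : Prop :=
  ∃ W : Set X, IsContinuum W ∧ p ∈ interior W ∧ W ⊆ {q}ᶜ

/-- `X` is aposyndetic at each point with respect to every other point. -/
def Aposyndetic (X : Type*) [MetricSpace X] : Prop :=
  ∀ p q : X, q ≠ p → AposyndeticAtWrt p q

end ContinuumTheory

/-!
Fix `q` and call the sets `kappa {q} z`, `z ≠ q`, the leaves of the complement of `q`. They partition
that complement and, as singletons are nonblockers, each is dense.

The property of Kelley thickens a subcontinuum with nonempty interior to one having a given point of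
the original in its interior (`PropertyOfKelley.aposyndeticAtWrt`). Since every leaf is dense, one
subcontinuum with nonempty interior missing `q` can be joined, off `q`, to any point `p ≠ q`. So if
aposyndesis fails for some `p` with respect to `q`, then `q` lies in every subcontinuum with nonempty
interior. It is shown that then finite nonblockers are close to the whole space, so the nonblockers
are not closed in the hyperspace (`top_mem_closure_nonblockers`).

In that situation every leaf is a countable union of nowhere dense continua, so by Baire's theorem
there are infinitely many leaves, and one can choose a finite set `F` with points in distinct leaves
meeting any finitely many open sets (`exists_finite_transverse`). Either `F` or `F ∪ {q}` is a
nonblocker. The only doubtful points `z` share a leaf with some `f ∈ F` and are joined to `q` by a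
continuum missing `f` (`Transverse.dense_kappa`). Call a leaf attached to `q` if it contains,
except for the point `q`, a nondegenerate continuum through `q`.

* If some leaf is attached, take `F` off that leaf. From `q` one can move off `F` into the attached
  leaf, which is dense. By boundary bumping the doubtful `z` gets arbitrarily close to `q` off `F`,
  and by lower semicontinuity of `kappa F` it inherits density (`dense_kappa_of_attachedLeaf`).
* If no leaf is attached, `kappa {q, f} z` is dense for doubtful `z`, since otherwise lower
  semicontinuity would produce an attaching continuum
  (`dense_kappa_pair_of_not_attachedLeaf`). So `F ∪ {q}` is a nonblocker.
-/

namespace ContinuumTheory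

variable {X : Type*} [MetricSpace X]

/-! ### Subcontinua -/

theorem isContinuum_singleton (x : X) : IsContinuum ({x} : Set X) :=
  ⟨isCompact_singleton, isConnected_singleton⟩

theorem IsContinuum.union {K L : Set X} (hK : IsContinuum K) (hL : IsContinuum L)
    (h : (K ∩ L).Nonempty) : IsContinuum (K ∪ L) :=
  ⟨hK.1.union hL.1, hK.2.union h hL.2⟩

theorem isClosed_connectedComponentIn {F : Set X} (hF : IsClosed F) (x : X) :
    IsClosed (connectedComponentIn F x) := by
  by_cases hx : x ∈ F
  · refine isClosed_of_closure_subset ?_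
    exact isPreconnected_connectedComponentIn.closure.subset_connectedComponentIn
      (subset_closure (mem_connectedComponentIn hx))
      (closure_minimal (connectedComponentIn_subset F x) hF)
  · rw [connectedComponentIn_eq_empty hx]
    exact isClosed_empty

theorem isContinuum_connectedComponentIn {F : Set X} (hF : IsCompact F) {x : X}
    (hx : x ∈ F) : IsContinuum (connectedComponentIn F x) :=
  ⟨hF.of_isClosed_subset (isClosed_connectedComponentIn hF.isClosed x)
    (connectedComponentIn_subset F x), isConnected_connectedComponentIn_iff.2 hx⟩

/-- Boundary bumping: inside a continuum `L`, the subcontinua that contain `z` and miss `q` come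
arbitrarily close to `q`. -/
theorem IsContinuum.exists_subcontinuum_near {L : Set X} (hL : IsContinuum L) {z q : X}
    (hz : z ∈ L) (hq : q ∈ L) (hzq : z ≠ q) {ε : ℝ} (hε : 0 < ε) :
    ∃ D ⊆ L, IsContinuum D ∧ z ∈ D ∧ q ∉ D ∧ ∃ w ∈ D, dist w q < ε := by
  obtain ⟨δ, hδ, hδε, hδz⟩ : ∃ δ > 0, δ < ε ∧ δ < dist z q := by
    have := lt_min hε (dist_pos.2 hzq)
    obtain ⟨δ, h1, h2⟩ := exists_between this
    exact ⟨δ, h1, h2.trans_le (min_le_left _ _), h2.trans_le (min_le_right _ _)⟩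
  set K : Set X := L ∩ {x | δ ≤ dist x q} with hK
  have hcl : IsClosed {x : X | δ ≤ dist x q} :=
    isClosed_le continuous_const (continuous_id.dist continuous_const)
  have hKc : IsCompact K := hL.1.inter_right hcl
  have hzK : z ∈ K := ⟨hz, hδz.le⟩
  refine ⟨connectedComponentIn K z, (connectedComponentIn_subset K z).trans inter_subset_left,
    isContinuum_connectedComponentIn hKc hzK, mem_connectedComponentIn hzK,
    fun h => ?_, ?_⟩
  · have : δ ≤ dist q q := (connectedComponentIn_subset K z h).2
    rw [dist_self] at this
    linarith
  by_contra! hfar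
  have : CompactSpace K := isCompact_iff_compactSpace.1 hKc
  -- The component of `z` in `K` avoids the sphere of radius `δ` about `q`; by compactness so does
  -- a relatively clopen neighbourhood of it, which then disconnects `L`.
  obtain ⟨s, hs, hzs, hsδ⟩ : ∃ s : Set K, IsClopen s ∧ (⟨z, hzK⟩ : K) ∈ s ∧
      ∀ x ∈ s, δ < dist (x : X) q := by
    let ι := { s : Set K // IsClopen s ∧ (⟨z, hzK⟩ : K) ∈ s }
    have : Nonempty ι := ⟨⟨univ, isClopen_univ, mem_univ _⟩⟩
    have hdir : Directed (· ⊇ ·) fun s : ι => (s : Set K) := fun s t =>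
      ⟨⟨s.1 ∩ t.1, s.2.1.inter t.2.1, s.2.2, t.2.2⟩, inter_subset_left, inter_subset_right⟩
    have hT : IsOpen {x : K | δ < dist (x : X) q} :=
      isOpen_lt continuous_const (continuous_subtype_val.dist continuous_const)
    have hsub : ∀ x ∈ ⋂ s : ι, (s : Set K), {x : K | δ < dist (x : X) q} ∈ 𝓝 x := by
      intro x hx
      rw [← connectedComponent_eq_iInter_isClopen] at hx
      refine hT.mem_nhds ?_
      have : (x : X) ∈ connectedComponentIn K z := by
        rw [connectedComponentIn_eq_image hzK]
        exact mem_image_of_mem _ hx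
      exact hδε.trans_le (hfar x this)
    obtain ⟨s, hs⟩ := exists_subset_nhds_of_isCompact hdir
      (fun s : ι => s.2.1.isClosed.isCompact) hsub
    exact ⟨s, s.2.1, s.2.2, hs⟩
  obtain ⟨U, hU, hUs⟩ := isOpen_induced_iff.1 hs.isOpen
  have hScl : IsClosed ((↑) '' s : Set X) :=
    (hs.isClosed.isCompact.image continuous_subtype_val).isClosed
  have hO : IsOpen (U ∩ {x | δ < dist x q}) :=
    hU.inter (isOpen_lt continuous_const (continuous_id.dist continuous_const))
  obtain ⟨y, hyL, ⟨x, hxs, rfl⟩, hy⟩ := isPreconnected_closed_iff.1 hL.2.isPreconnected _ _ hScl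
    hO.isClosed_compl
    (by
      intro x hx
      by_cases h : x ∈ U ∩ {x | δ < dist x q}
      · left
        have hxδ : δ < dist x q := h.2
        have hxK : x ∈ K := ⟨hx, hxδ.le⟩
        refine ⟨⟨x, hxK⟩, ?_, rfl⟩
        rw [← hUs]
        exact h.1
      · exact Or.inr h)
    ⟨z, hz, ⟨z, hzK⟩, hzs, rfl⟩
    ⟨q, hq, fun h => by
      have : δ < dist q q := h.2
      rw [dist_self] at this
      linarith⟩
  refine hy ⟨?_, hsδ x hxs⟩
  rw [← hUs] at hxs
  exact hxs

/-! ### The sets `kappa A x` -/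

theorem mem_kappa {A : Set X} {x w : X} :
    w ∈ kappa A x ↔ ∃ L, IsContinuum L ∧ x ∈ L ∧ L ⊆ Aᶜ ∧ w ∈ L := by
  simp only [kappa, mem_sUnion, mem_ofPred_eq]
  exact ⟨fun ⟨L, ⟨h1, h2, h3⟩, h4⟩ => ⟨L, h1, h2, h3, h4⟩,
    fun ⟨L, h1, h2, h3, h4⟩ => ⟨L, ⟨h1, h2, h3⟩, h4⟩⟩

theorem self_mem_kappa {A : Set X} {x : X} (hx : x ∉ A) : x ∈ kappa A x :=
  mem_kappa.2 ⟨{x}, isContinuum_singleton x, rfl, singleton_subset_iff.2 hx, rfl⟩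

theorem notMem_of_mem_kappa {A : Set X} {x w : X} (h : w ∈ kappa A x) : w ∉ A := by
  obtain ⟨L, -, -, hLA, hw⟩ := mem_kappa.1 h
  exact hLA hw

theorem ne_of_mem_kappa {q x w : X} (h : w ∈ kappa {q} x) : w ≠ q :=
  notMem_of_mem_kappa (A := {q}) h

theorem mem_kappa_comm {A : Set X} {x w : X} : w ∈ kappa A x ↔ x ∈ kappa A w := by
  simp only [mem_kappa]
  exact ⟨fun ⟨L, h1, h2, h3, h4⟩ => ⟨L, h1, h4, h3, h2⟩,
    fun ⟨L, h1, h2, h3, h4⟩ => ⟨L, h1, h4, h3, h2⟩⟩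

theorem mem_kappa_trans {A : Set X} {x y z : X} (hy : y ∈ kappa A x) (hz : z ∈ kappa A y) :
    z ∈ kappa A x := by
  obtain ⟨L, hL, hxL, hLA, hyL⟩ := mem_kappa.1 hy
  obtain ⟨M, hM, hyM, hMA, hzM⟩ := mem_kappa.1 hz
  exact mem_kappa.2 ⟨L ∪ M, hL.union hM ⟨y, hyL, hyM⟩, Or.inl hxL, union_subset hLA hMA,
    Or.inr hzM⟩

theorem kappa_eq_of_mem {A : Set X} {x y : X} (hy : y ∈ kappa A x) : kappa A y = kappa A x :=
  Subset.antisymm (fun _ hz => mem_kappa_trans hy hz)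
    fun _ hz => mem_kappa_trans (mem_kappa_comm.1 hy) hz

/-! ### Consequences of the property of Kelley -/

/-- In a space with the property of Kelley, `kappa A` is lower semicontinuous off `A`. -/
theorem PropertyOfKelley.isOpen_setOf_kappa_inter (hX : PropertyOfKelley X) {A V : Set X}
    (hA : IsClosed A) (hV : IsOpen V) : IsOpen {x | (kappa A x ∩ V).Nonempty} := by
  rw [← isClosed_compl_iff]
  refine IsSeqClosed.isClosed fun x a hx hxa ha => ?_
  obtain ⟨v, hv, hvV⟩ := ha
  obtain ⟨L, hL, haL, hLA, hvL⟩ := mem_kappa.1 hv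
  obtain ⟨B, hB, hBL⟩ := hX x a hxa ⟨⟨L, hL.1⟩, hL.2.nonempty⟩ hL haL
  have h1 := hBL.eventually
    ((NonemptyCompacts.isOpen_subsets_of_isOpen hA.isOpen_compl).mem_nhds hLA)
  have h2 := hBL.eventually
    ((NonemptyCompacts.isOpen_inter_nonempty_of_isOpen hV).mem_nhds ⟨v, hvL, hvV⟩)
  obtain ⟨n, hn1, w, hwB, hwV⟩ := (h1.and h2).exists
  exact hx n ⟨w, mem_kappa.2 ⟨B n, (hB n).1, (hB n).2, hn1, hwB⟩, hwV⟩

/-- In a space with the property of Kelley, every point of a subcontinuum `W` with nonempty interior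
is interior to a slightly larger subcontinuum: nearby points lie on continua close to `W`, and these
meet `W`. -/
theorem PropertyOfKelley.aposyndeticAtWrt [CompactSpace X] (hX : PropertyOfKelley X) {W : Set X}
    (hW : IsContinuum W) (hint : (interior W).Nonempty) {p q : X} (hp : p ∈ W) (hq : q ∉ W) :
    AposyndeticAtWrt p q := by
  obtain ⟨U, hU, hWU, hqU⟩ : ∃ U, IsOpen U ∧ W ⊆ U ∧ q ∉ closure U := by
    obtain ⟨U, V, hU, hV, hWU, hqV, hUV⟩ := SeparatedNhds.of_isCompact_isCompact hW.1
      (isCompact_singleton (x := q)) (disjoint_singleton_right.2 hq)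
    exact ⟨U, hU, hWU, fun h => (hUV.closure_left hV).le_bot ⟨h, hqV rfl⟩⟩
  have hpU : p ∈ closure U := subset_closure (hWU hp)
  refine ⟨connectedComponentIn (closure U) p,
    isContinuum_connectedComponentIn isClosed_closure.isCompact hpU, ?_,
    fun x hx h => hqU (h ▸ connectedComponentIn_subset _ _ hx)⟩
  by_contra hpi
  rw [← notMem_compl_iff, not_not, ← closure_compl, mem_closure_iff_seq_limit] at hpi
  obtain ⟨x, hx, hxp⟩ := hpi
  obtain ⟨B, hB, hBW⟩ := hX x p hxp ⟨⟨W, hW.1⟩, hW.2.nonempty⟩ hW hp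
  have h1 := hBW.eventually ((NonemptyCompacts.isOpen_subsets_of_isOpen hU).mem_nhds hWU)
  have h2 := hBW.eventually ((NonemptyCompacts.isOpen_inter_nonempty_of_isOpen
    (isOpen_interior (s := W))).mem_nhds (hint.mono fun w hw => ⟨interior_subset hw, hw⟩))
  obtain ⟨n, hn1, w, hwB, hwW⟩ := (h1.and h2).exists
  have hBn : IsContinuum ((B n : Set X) ∪ W) := (hB n).1.union hW ⟨w, hwB, interior_subset hwW⟩
  exact hx n (hBn.2.isPreconnected.subset_connectedComponentIn (Or.inr hp)
    ((union_subset hn1 hWU).trans subset_closure) (Or.inl (hB n).2))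

/-! ### Leaves of the complement of a point -/

/-- If `q` lies in every subcontinuum with nonempty interior, the leaves `kappa {q} t` are meagre, so
by the Baire category theorem finitely many of them do not cover the complement of `q`. -/
theorem exists_forall_notMem_kappa [CompactSpace X] [Nonempty X] {q : X}
    (hq : ∀ M : Set X, IsContinuum M → (interior M).Nonempty → q ∈ M)
    (hqi : interior ({q} : Set X) = ∅) {T : Set X} (hT : T.Finite) :
    ∃ z, z ≠ q ∧ ∀ t ∈ T, z ∉ kappa {q} t := by
  by_contra! h
  have : Countable T := hT.countable
  have hcl : ∀ n : ℕ, IsClosed {x : X | 1 / ((n : ℝ) + 1) ≤ dist x q} := fun n =>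
    isClosed_le continuous_const (continuous_id.dist continuous_const)
  let f : Option (T × ℕ) → Set X
    | none => {q}
    | some i => connectedComponentIn {x | 1 / ((i.2 : ℝ) + 1) ≤ dist x q} i.1
  have hf : ∀ i, IsClosed (f i) := by
    rintro (_ | i)
    · exact isClosed_singleton
    · exact isClosed_connectedComponentIn (hcl i.2) _
  have hcov : ⋃ i, f i = univ := by
    refine eq_univ_of_forall fun z => mem_iUnion.2 ?_
    by_cases hz : z = q
    · exact ⟨none, hz⟩
    obtain ⟨t, ht, hzt⟩ := h z hz
    obtain ⟨L, hL, htL, hLq, hzL⟩ := mem_kappa.1 hzt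
    have hqL : q ∉ L := fun hqL => hLq hqL rfl
    obtain ⟨n, hn⟩ := exists_nat_one_div_lt
      ((hL.1.isClosed.notMem_iff_infDist_pos hL.2.nonempty).1 hqL)
    refine ⟨some (⟨t, ht⟩, n), hL.2.isPreconnected.subset_connectedComponentIn htL ?_ hzL⟩
    intro x hx
    have := Metric.infDist_le_dist_of_mem (x := q) hx
    rw [dist_comm] at this
    exact hn.le.trans this
  obtain ⟨i, hi⟩ := nonempty_interior_of_iUnion_of_closed hf hcov
  rcases i with _ | ⟨t, n⟩
  · exact hi.ne_empty hqi
  · have hc : IsContinuum (f (some (t, n))) := isContinuum_connectedComponentIn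
      (hcl n).isCompact (connectedComponentIn_nonempty_iff.1 (hi.mono interior_subset))
    have hqc := connectedComponentIn_subset _ _ (hq _ hc hi)
    have : 1 / ((n : ℝ) + 1) ≤ dist q q := hqc
    rw [dist_self] at this
    exact absurd this (not_le.2 (by positivity))

/-- A set of points other than `q` is transverse (to the leaves of the complement of `q`) if no two
of its points lie in a common subcontinuum missing `q`. -/
def Transverse (q : X) (F : Set X) : Prop :=
  ∀ f ∈ F, f ≠ q ∧ ∀ g ∈ F, g ∈ kappa {q} f → g = f

theorem Transverse.subset_compl {q : X} {F : Set X} (hF : Transverse q F) {f z : X} (hf : f ∈ F)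
    (hz : z ∈ kappa {q} f) {L : Set X} (hL : IsContinuum L) (hzL : z ∈ L) (hqL : q ∉ L)
    (hfL : f ∉ L) : L ⊆ Fᶜ := by
  intro g hgL hgF
  have hg : g ∈ kappa {q} z := mem_kappa.2 ⟨L, hL, hzL, subset_compl_singleton_iff.2 hqL, hgL⟩
  exact hfL ((hF f hf).2 g hgF (mem_kappa_trans hz hg) ▸ hgL)

/-- As there are infinitely many leaves and each is dense, a finite transverse set can be made to
meet finitely many prescribed open sets, and to avoid a prescribed leaf. -/
theorem exists_finite_transverse [CompactSpace X] [Nonempty X] {q : X}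
    (hq : ∀ M : Set X, IsContinuum M → (interior M).Nonempty → q ∈ M)
    (hqi : interior ({q} : Set X) = ∅) (hd : ∀ z, z ≠ q → Dense (kappa {q} z)) (y : X)
    {u : Set (Set X)} (hu : u.Finite) (huo : ∀ U ∈ u, IsOpen U ∧ U.Nonempty) :
    ∃ F : Set X, F.Finite ∧ Transverse q F ∧ (∀ U ∈ u, (F ∩ U).Nonempty) ∧
      ∀ f ∈ F, f ∉ kappa {q} y := by
  induction u, hu using Set.Finite.induction_on with
  | empty => exact ⟨∅, finite_empty, by simp [Transverse], by simp, by simp⟩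
  | @insert U u _ _ ih =>
    obtain ⟨F, hFf, hFt, hFu, hFy⟩ := ih fun V hV => huo V (Or.inr hV)
    obtain ⟨z, hzq, hz⟩ := exists_forall_notMem_kappa hq hqi (hFf.insert y)
    obtain ⟨f, hfU, hfz⟩ := (hd z hzq).inter_open_nonempty U (huo U (Or.inl rfl)).1
      (huo U (Or.inl rfl)).2
    have hft : ∀ t ∈ insert y F, f ∉ kappa {q} t := fun t ht hf =>
      hz t ht (mem_kappa_trans hf (mem_kappa_comm.1 hfz))
    refine ⟨insert f F, hFf.insert f, ?_, ?_, ?_⟩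
    · rintro a (rfl | ha)
      · refine ⟨ne_of_mem_kappa hfz, ?_⟩
        rintro g (rfl | hg) hga
        · rfl
        · exact absurd (mem_kappa_comm.1 hga) (hft g (Or.inr hg))
      · refine ⟨(hFt a ha).1, ?_⟩
        rintro g (rfl | hg) hga
        · exact absurd hga (hft a (Or.inr ha))
        · exact (hFt a ha).2 g hg hga
    · rintro V (rfl | hV)
      · exact ⟨f, Or.inl rfl, hfU⟩
      · exact (hFu V hV).mono (inter_subset_inter_left _ (subset_insert _ _))
    · rintro a (rfl | ha)
      · exact hft y (Or.inl rfl)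
      · exact hFy a ha

/-! ### Finite nonblockers -/

/-- For a finite transverse set `F` and `A = F` or `A = F ∪ {q}`, the only points `z` at which density
of `kappa A z` is in doubt are those on the leaf of some `f ∈ F` that a continuum missing `f` joins
to `q`. -/
theorem Transverse.dense_kappa {q : X} {F A : Set X} (hF : Transverse q F)
    (hFA : F ⊆ A) (hA : A ⊆ insert q F) (hd : ∀ x z : X, z ≠ x → Dense (kappa {x} z))
    (h : ∀ f ∈ F, ∀ z ∈ kappa {q} f, z ∉ A → q ∈ kappa {f} z → Dense (kappa A z))
    {z : X} (hzA : z ∉ A) (hzq : z ≠ q) : Dense (kappa A z) := by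
  have hsub : ∀ L : Set X, q ∉ L → L ⊆ Fᶜ → L ⊆ Aᶜ := by
    intro L hqL hLF x hx hxA
    rcases hA hxA with rfl | hxF
    · exact hqL hx
    · exact hLF hx hxF
  by_cases hz : ∃ f ∈ F, z ∈ kappa {q} f
  · obtain ⟨f, hf, hzf⟩ := hz
    by_cases hqf : q ∈ kappa {f} z
    · exact h f hf z hzf hzA hqf
    · refine (hd f z fun hzf' => hzA (hFA (hzf' ▸ hf))).mono fun w hw => ?_
      obtain ⟨L, hL, hzL, hLf, hwL⟩ := mem_kappa.1 hw
      have hqL : q ∉ L := fun hqL => hqf (mem_kappa.2 ⟨L, hL, hzL, hLf, hqL⟩)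
      exact mem_kappa.2 ⟨L, hL, hzL, hsub L hqL (hF.subset_compl hf hzf hL hzL hqL
        (subset_compl_singleton_iff.1 hLf)), hwL⟩
  · push Not at hz
    refine (hd q z hzq).mono fun w hw => ?_
    obtain ⟨L, hL, hzL, hLq, hwL⟩ := mem_kappa.1 hw
    refine mem_kappa.2 ⟨L, hL, hzL, hsub L (subset_compl_singleton_iff.1 hLq) ?_, hwL⟩
    exact fun g hgL hgF => hz g hgF (mem_kappa.2 ⟨L, hL, hgL, hLq, hzL⟩)

/-- The leaf of `y` is attached to `q` if some continuum through `y` and `q` lies in that leaf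
except for the point `q`. -/
def AttachedLeaf (q y : X) : Prop :=
  y ≠ q ∧ ∃ J : Set X, IsContinuum J ∧ q ∈ J ∧ y ∈ J ∧ J \ {q} ⊆ kappa {q} y

/-- If the leaf of `y` is attached to `q`, a finite transverse set missing that leaf is a nonblocker:
from `q` one reaches the dense leaf of `y`, and every leaf point joined to `q` can follow. -/
theorem dense_kappa_of_attachedLeaf (hX : PropertyOfKelley X)
    (hd : ∀ x z : X, z ≠ x → Dense (kappa {x} z)) {q y : X} (hy : AttachedLeaf q y) {F : Set X}
    (hFf : F.Finite) (hF : Transverse q F) (hFy : ∀ f ∈ F, f ∉ kappa {q} y) {z : X}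
    (hz : z ∉ F) : Dense (kappa F z) := by
  obtain ⟨hyq, J, hJ, hqJ, hyJ, hJy⟩ := hy
  have hqF : q ∉ F := fun h => (hF q h).1 rfl
  have hdq : Dense (kappa F q) := by
    refine (hd q y hyq).mono fun w hw => ?_
    obtain ⟨L, hL, hyL, hLq, hwL⟩ := mem_kappa.1 hw
    refine mem_kappa.2 ⟨L ∪ J, hL.union hJ ⟨y, hyL, hyJ⟩, Or.inr hqJ, ?_, Or.inl hwL⟩
    rintro g (hg | hg) hgF
    · exact hFy g hgF (mem_kappa.2 ⟨L, hL, hyL, hLq, hg⟩)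
    · exact hFy g hgF (hJy ⟨hg, (hF g hgF).1⟩)
  by_cases hzq : z = q
  · exact hzq ▸ hdq
  refine hF.dense_kappa Subset.rfl (subset_insert _ _) hd ?_ hz hzq
  intro f hf z hzf hzF hqz
  have hzq : z ≠ q := ne_of_mem_kappa hzf
  obtain ⟨L, hL, hzL, hLf, hqL⟩ := mem_kappa.1 hqz
  refine dense_iff_inter_open.2 fun V hV hVne => ?_
  have hO := hX.isOpen_setOf_kappa_inter hFf.isClosed hV
  have hqO : (kappa F q ∩ V).Nonempty := by
    rw [inter_comm]
    exact hdq.inter_open_nonempty V hV hVne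
  obtain ⟨ε, hε, hball⟩ := Metric.isOpen_iff.1 hO q hqO
  obtain ⟨D, hDL, hD, hzD, hqD, w, hwD, hwq⟩ := hL.exists_subcontinuum_near hzL hqL hzq hε
  have hw : w ∈ kappa F z := mem_kappa.2 ⟨D, hD, hzD, hF.subset_compl hf hzf hD hzD hqD
    fun h => hLf (hDL h) rfl, hwD⟩
  have hwV : (kappa F w ∩ V).Nonempty := hball hwq
  rwa [kappa_eq_of_mem hw, inter_comm] at hwV

/-- If a continuum joins `z` to `q` off `f`, where `f` lies on the leaf of `z`, but `kappa {q, f} z`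
is not dense, then lower semicontinuity keeps the closure of the part of that continuum reached from
`z` inside the leaf, which is therefore attached to `q`. -/
theorem dense_kappa_pair_of_not_attachedLeaf (hX : PropertyOfKelley X)
    (hd : ∀ x z : X, z ≠ x → Dense (kappa {x} z)) {q f z : X} (hzf : z ∈ kappa {q} f)
    (hqz : q ∈ kappa {f} z) (hz : ¬ AttachedLeaf q z) : Dense (kappa {q, f} z) := by
  have hzq : z ≠ q := ne_of_mem_kappa hzf
  obtain ⟨L, hL, hzL, hLf, hqL⟩ := mem_kappa.1 hqz
  refine dense_iff_inter_open.2 fun V hV hVne => ?_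
  by_contra hVz
  set C : Set X := ⋃₀ {D | IsContinuum D ∧ z ∈ D ∧ D ⊆ L ∧ q ∉ D} with hC
  have hzC : z ∈ C := ⟨{z}, ⟨isContinuum_singleton z, rfl, singleton_subset_iff.2 hzL,
    fun h => hzq h.symm⟩, rfl⟩
  have hCL : closure C ⊆ L := closure_minimal (sUnion_subset fun D hD => hD.2.2.1) hL.1.isClosed
  have hCc : IsPreconnected C :=
    isPreconnected_sUnion z _ (fun D hD => hD.2.1) fun D hD => hD.1.2.isPreconnected
  refine hz ⟨hzq, closure C, ⟨hL.1.of_isClosed_subset isClosed_closure hCL,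
    ⟨z, subset_closure hzC⟩, hCc.closure⟩, ?_, subset_closure hzC, ?_⟩
  · refine Metric.mem_closure_iff.2 fun ε hε => ?_
    obtain ⟨D, hDL, hD, hzD, hqD, w, hwD, hwq⟩ := hL.exists_subcontinuum_near hzL hqL hzq hε
    exact ⟨w, ⟨D, ⟨hD, hzD, hDL, hqD⟩, hwD⟩, by rwa [dist_comm]⟩
  · rintro w ⟨hwC, hwq⟩
    by_contra hwz
    have hwd : Dense (kappa {q, f} w) := by
      refine (hd q w hwq).mono fun v hv => ?_
      obtain ⟨M, hM, hwM, hMq, hvM⟩ := mem_kappa.1 hv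
      refine mem_kappa.2 ⟨M, hM, hwM, ?_, hvM⟩
      rintro x hx (rfl | rfl)
      · exact hMq hx rfl
      · exact hwz (mem_kappa_trans (mem_kappa_comm.1 hzf) (mem_kappa.2 ⟨M, hM, hx, hMq, hwM⟩))
    have hO := hX.isOpen_setOf_kappa_inter (toFinite ({q, f} : Set X)).isClosed hV
    have hwO : (kappa {q, f} w ∩ V).Nonempty := by
      rw [inter_comm]
      exact hwd.inter_open_nonempty V hV hVne
    obtain ⟨c, hcO, D, ⟨hD, hzD, hDL, hqD⟩, hcD⟩ := mem_closure_iff.1 hwC _ hO hwO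
    have hcz : c ∈ kappa {q, f} z := by
      refine mem_kappa.2 ⟨D, hD, hzD, ?_, hcD⟩
      rintro x hx (rfl | rfl)
      · exact hqD hx
      · exact hLf (hDL hx) rfl
    rw [mem_ofPred_eq, kappa_eq_of_mem hcz, inter_comm] at hcO
    exact hVz hcO

/-- If no leaf is attached to `q`, a finite transverse set together with `q` is a nonblocker. -/
theorem dense_kappa_insert_of_not_attachedLeaf (hX : PropertyOfKelley X)
    (hd : ∀ x z : X, z ≠ x → Dense (kappa {x} z)) {q : X} (hq : ∀ y, ¬ AttachedLeaf q y)
    {F : Set X} (hF : Transverse q F) {z : X} (hz : z ∉ insert q F) :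
    Dense (kappa (insert q F) z) := by
  refine hF.dense_kappa (subset_insert _ _) Subset.rfl hd ?_ hz fun h => hz (Or.inl h)
  intro f hf z hzf hzA hqz
  refine (dense_kappa_pair_of_not_attachedLeaf hX hd hzf hqz (hq z)).mono fun w hw => ?_
  obtain ⟨L, hL, hzL, hLA, hwL⟩ := mem_kappa.1 hw
  have hqL : q ∉ L := fun h => hLA h (Or.inl rfl)
  have hLF := hF.subset_compl hf hzf hL hzL hqL fun h => hLA h (Or.inr rfl)
  refine mem_kappa.2 ⟨L, hL, hzL, ?_, hwL⟩
  rintro x hx (rfl | hxF)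
  · exact hqL hx
  · exact hLF hx hxF

/-- If some point lies in every subcontinuum with nonempty interior, the whole space is a limit of
finite nonblockers. -/
theorem top_mem_closure_nonblockers [CompactSpace X] [Nonempty X] (hX : PropertyOfKelley X)
    (hd : ∀ x z : X, z ≠ x → Dense (kappa {x} z)) {q y : X} (hyq : y ≠ q)
    (hq : ∀ M : Set X, IsContinuum M → (interior M).Nonempty → q ∈ M) :
    (⊤ : NonemptyCompacts X) ∈ closure (nonblockers X) := by
  have hqi : interior ({q} : Set X) = ∅ := by
    by_contra h
    obtain ⟨w, hw, hwy⟩ := (hd q y hyq).inter_open_nonempty _ isOpen_interior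
      (nonempty_iff_ne_empty.2 h)
    exact notMem_of_mem_kappa hwy (interior_subset hw)
  refine NonemptyCompacts.isTopologicalBasis.mem_closure_iff.2 ?_
  rintro _ ⟨u, ⟨huf, hune, huo⟩, rfl⟩ ⟨hcov, hmeet⟩
  -- It suffices to find a finite nonblocker meeting all members of the finite open cover `u`.
  suffices h : ∃ A : Set X, A.Finite ∧ (∀ U ∈ u, (A ∩ U).Nonempty) ∧ A ≠ univ ∧
      ∀ z ∉ A, Dense (kappa A z) by
    obtain ⟨A, hA, hAu, hne, hAd⟩ := h
    obtain ⟨U, hU⟩ := hune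
    exact ⟨⟨⟨A, hA.isCompact⟩, (hAu U hU).mono inter_subset_left⟩,
      ⟨fun x _ => hcov (mem_univ x), hAu⟩, hne, hAd⟩
  have huo' : ∀ U ∈ u, IsOpen U ∧ U.Nonempty := fun U hU =>
    ⟨huo U hU, (hmeet U hU).mono inter_subset_right⟩
  by_cases hatt : ∃ y, AttachedLeaf q y
  · obtain ⟨y, hy⟩ := hatt
    obtain ⟨F, hFf, hFt, hFu, hFy⟩ := exists_finite_transverse hq hqi (hd q) y huf huo'
    exact ⟨F, hFf, hFu, fun h => (hFt q (h ▸ mem_univ q)).1 rfl,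
      fun z hz => dense_kappa_of_attachedLeaf hX hd hy hFf hFt hFy hz⟩
  · push Not at hatt
    obtain ⟨F, hFf, hFt, hFu, hFy⟩ := exists_finite_transverse hq hqi (hd q) y huf huo'
    refine ⟨insert q F, hFf.insert q,
      fun U hU => (hFu U hU).mono (inter_subset_inter_left _ (subset_insert _ _)), fun h => ?_,
      fun z hz => dense_kappa_insert_of_not_attachedLeaf hX hd hatt hFt hz⟩
    rcases h ▸ mem_univ y with h' | h'
    · exact hyq h'
    · exact hFy y h' (self_mem_kappa hyq)

/-! ### Aposyndesis -/

theorem aposyndetic_of_isClosed_nonblockers [CompactSpace X] [Nonempty X] (hX : PropertyOfKelley X)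
    (hF : singletons X ⊆ nonblockers X) (hNB : IsClosed (nonblockers X)) : Aposyndetic X := by
  intro p q hqp
  have hd : ∀ x z : X, z ≠ x → Dense (kappa {x} z) := fun x z hz =>
    (hF ⟨x, rfl⟩ : ({x} : NonemptyCompacts X) ∈ nonblockers X).2 z hz
  by_contra hpq
  -- A continuum with interior missing `q` could be extended, off `q`, to one containing `p`.
  have hq : ∀ M : Set X, IsContinuum M → (interior M).Nonempty → q ∈ M := by
    intro M hM hint
    by_contra hqM
    obtain ⟨w, hw, hwp⟩ := (hd q p hqp.symm).inter_open_nonempty _ isOpen_interior hint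
    obtain ⟨L, hL, hpL, hLq, hwL⟩ := mem_kappa.1 hwp
    refine hpq (hX.aposyndeticAtWrt (hL.union hM ⟨w, hwL, interior_subset hw⟩)
      (hint.mono (interior_mono subset_union_right)) (Or.inl hpL) ?_)
    rintro (h | h)
    · exact hLq h rfl
    · exact hqM h
  have htop := top_mem_closure_nonblockers hX hd hqp.symm hq
  rw [hNB.closure_eq] at htop
  exact htop.1 NonemptyCompacts.coe_top

end ContinuumTheory

theorem mainTheorem4 (X : Type*) [MetricSpace X] [CompactSpace X] [ConnectedSpace X]
    (hdec : ContinuumTheory.Decomposable X)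
    (hKelley : ContinuumTheory.PropertyOfKelley X)
    (hF : ContinuumTheory.singletons X ⊆ ContinuumTheory.nonblockers X)
    (hNB : ContinuumTheory.IsContinuum (ContinuumTheory.nonblockers X)) :
    ContinuumTheory.Aposyndetic X :=
  ContinuumTheory.aposyndetic_of_isClosed_nonblockers hKelley hF hNB.1.isClosed
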